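/- Let $F$ be a free group (of any rank, finite or infinite) and let $x\in F$; if $F$ is infinite cyclic, assume in addition that $x\neq 1$. Call $x$ separable if $F=F_1\ast F_2$ for some nontrivial subgroups $F_1,F_2\le F$ such that $x$ is conjugate in $F$ to an element of $F_1$ or of $F_2$. For a free basis $B$ of $F$, let $w_1w_2\cdots w_n$ (with $w_i\in B\cup B^{-1}$) be a cyclically reduced word in $B$ representing a conjugate of $x$; it is unique up to cyclic permutation. The Whitehead graph $Wh_B(x)$ has vertex set $B\sqcup B^{-1}$ and, for each $i=1,\dots,n$, an edge joining $w_i$ to $w_{i+1}^{-1}$, where $w_{n+1}:=w_1$. A graph is called disconnected if it has two vertices that are not joined by a path (so the empty graph is not disconnected), and a vertex $v$ is called a cut-vertex if removing $v$ increases the number of connected components. Then $x$ is separable if and only if, for every free basis $B$ of $F$, the graph $Wh_B(x)$ is disconnected or has a cut-vertex. -/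

import Mathlib

universe u

/-- `F` is the internal free product `F₁ ∗ F₂` of its subgroups `F₁` and `F₂`: the canonical
homomorphism from the free product to `F` is an isomorphism. -/
def IsInternalFreeProduct {F : Type*} [Group F] (F₁ F₂ : Subgroup F) : Prop :=
  Function.Bijective (Monoid.Coprod.lift F₁.subtype F₂.subtype)

/-- A finite subset `A` of `F` is separable if `F = F₁ ∗ F₂` with both factors nontrivial, so that
every element of `A` is conjugate to an element of `F₁` or to an element of `F₂`. -/
def IsSeparableSet {F : Type*} [Group F] (A : Finset F) : Prop :=
  ∃ F₁ F₂ : Subgroup F, F₁ ≠ ⊥ ∧ F₂ ≠ ⊥ ∧ IsInternalFreeProduct F₁ F₂ ∧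
    ∀ a ∈ A, (∃ g : F, g * a * g⁻¹ ∈ F₁) ∨ (∃ g : F, g * a * g⁻¹ ∈ F₂)

open Classical in
/-- A cyclically reduced word in the basis `B` that represents a conjugate of `x` (it is unique up
to cyclic permutation). The letter `(i, true)` stands for `B i`, and `(i, false)` for `(B i)⁻¹`. -/
noncomputable def cyclicWord {F ι : Type*} [Group F] (B : FreeGroupBasis ι F) (x : F) :
    List (ι × Bool) :=
  FreeGroup.reduceCyclically (B.repr x).toWord

/-- The Whitehead graph of `x` with respect to the basis `B`. There are two vertices for each basis
element `B i`, namely `(i, true)`, labelled `B i`, and `(i, false)`, labelled `(B i)⁻¹`. For each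
pair `w₁ w₂` of cyclically consecutive letters of the cyclically reduced word of `x` there is an
edge between `w₁` and `w₂⁻¹`. Multiplicities of edges are not recorded; there are no loops, since
the word is cyclically reduced. -/
noncomputable def whiteheadGraph {F ι : Type*} [Group F] (B : FreeGroupBasis ι F) (x : F) :
    SimpleGraph (ι × Bool) :=
  SimpleGraph.fromRel fun u v =>
    (u, (v.1, !v.2)) ∈ (cyclicWord B x).zip ((cyclicWord B x).rotate 1)

/-- A vertex `v` is a cut-vertex of `G` if removing `v` (with its edges) leaves a graph with more
connected components than `G`. -/
def IsCutVertex {V : Type*} (G : SimpleGraph V) (v : V) : Prop :=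
  Cardinal.mk G.ConnectedComponent < Cardinal.mk (G.induce {v}ᶜ).ConnectedComponent

/-!
Take a basis for which the cyclic word of `x` is shortest. If its Whitehead graph has a cut-vertex,
or is disconnected so that some component contains a vertex `v` but not `v⁻¹`, where `v` or `v⁻¹`
occurs in the word, then a Whitehead move with multiplier `v` shortens the word, which is
impossible. So the graph is disconnected; unless a basis element does not occur in the word at all,
its components are closed under inversion. In both cases the basis splits into two parts such that
the word uses letters from only one of them, and `x` is separable.

Conversely, let `F = F₁ ∗ F₂` with `x ≠ 1` conjugate into a factor, and let `P` be the set of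
elements whose normal form begins in `F₂`. Right translations change `P` at finitely many points
only, `P` and its complement are infinite, and along the axis of a conjugate of `x` in the Cayley
tree membership in `P` is constant outside a finite set. The edges of the Whitehead graph at a
vertex `g` of the tree are the pairs of directions in which such axes leave `g`. If the graph is
connected without a cut-vertex, the directions pointing away from the root remain linked by axes, so
constancy of membership in `P` propagates from the deep cones to the whole tree: `P` or its
complement is finite, a contradiction.
-/

section CyclicLists

variable {β : Type*}

theorem exists_rotate_of_mem_zip_rotate {L : List β} {u v : β} (h : (u, v) ∈ L.zip (L.rotate 1)) :
    ∃ n, (L.rotate n).head? = some v ∧ (L.rotate n).getLast? = some u := by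
  obtain ⟨i, hi, hiuv⟩ := List.mem_iff_getElem.1 h
  simp only [List.length_zip, List.length_rotate, min_self] at hi
  simp only [List.getElem_zip, List.getElem_rotate, Prod.mk.injEq] at hiuv
  have hlast : (L.length - 1 + (i + 1)) % L.length = i := by
    rw [show L.length - 1 + (i + 1) = i + L.length by omega, Nat.add_mod_right,
      Nat.mod_eq_of_lt hi]
  refine ⟨i + 1, ?_, ?_⟩
  · rw [List.head?_eq_getElem?, List.getElem?_eq_getElem (by simp; omega), List.getElem_rotate,
      ← hiuv.2]
    simp only [zero_add]
  · rw [List.getLast?_eq_getElem?, List.getElem?_eq_getElem (by simp; omega), List.getElem_rotate,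
      ← hiuv.1]
    simp only [List.length_rotate, hlast]

theorem forall_mem_or_forall_not_of_zip_rotate {L : List β} {p : β → Prop}
    (h : ∀ u v, (u, v) ∈ L.zip (L.rotate 1) → (p u ↔ p v)) :
    (∀ a ∈ L, p a) ∨ ∀ a ∈ L, ¬ p a := by
  have iff_head : ∀ i (hi : i < L.length), p L[i] ↔ p L[0] := by
    intro i hi
    induction i with
    | zero => rfl
    | succ i ih =>
      have hzip : i < (L.zip (L.rotate 1)).length := by simp; omega
      have hstep := List.getElem_mem hzip
      rw [List.getElem_zip, List.getElem_rotate] at hstep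
      simp only [Nat.mod_eq_of_lt hi] at hstep
      exact (h _ _ hstep).symm.trans (ih (by omega))
  simp only [List.forall_mem_iff_getElem]
  by_cases h₀ : ∀ hL : 0 < L.length, p L[0]
  · exact Or.inl fun i hi => (iff_head i hi).2 (h₀ _)
  · obtain ⟨_, h₀⟩ := not_forall.1 h₀
    exact Or.inr fun i hi hpi => h₀ ((iff_head i hi).1 hpi)

theorem prod_map_mul_cons_mul {M : Type*} [Monoid M] (c d : β → M) (a b : β) (L : List β) :
    ((a :: L).map fun w => c w * d w).prod * c b =
      c a * (((a :: L).zip (L ++ [b])).map fun r => d r.1 * c r.2).prod := by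
  induction L generalizing a with
  | nil => simp [mul_assoc]
  | cons a' L ih =>
    rw [List.map_cons, List.prod_cons, mul_assoc, ih a']
    simp [mul_assoc]

theorem isConj_prod_zip_rotate {G : Type*} [Group G] (c d : β → G) (L : List β) :
    IsConj ((L.zip (L.rotate 1)).map fun r => d r.1 * c r.2).prod
      (L.map fun w => c w * d w).prod := by
  cases L with
  | nil => simp
  | cons a L =>
    rw [isConj_iff, List.rotate_cons_succ, List.rotate_zero]
    exact ⟨c a, by rw [← prod_map_mul_cons_mul, mul_inv_cancel_right]⟩

theorem countP_lt_countP {p q : β → Bool} {L : List β} (h : ∀ b ∈ L, p b → q b)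
    (hlt : ∃ b ∈ L, q b ∧ ¬ p b) : L.countP p < L.countP q := by
  have hfilter : (L.filter q).filter p = L.filter p := by
    rw [List.filter_filter]
    exact List.filter_congr fun b hb => by have := h b hb; cases hp : p b <;> simp_all
  rw [List.countP_eq_length_filter, List.countP_eq_length_filter, ← hfilter,
    List.length_filter_lt_length_iff_exists]
  obtain ⟨b, hb, hq, hp⟩ := hlt
  exact ⟨b, List.mem_filter.2 ⟨hb, hq⟩, hp⟩

theorem countP_or_le (p q : β → Bool) (L : List β) :
    L.countP (fun b => p b || q b) ≤ L.countP p + L.countP q := by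
  induction L with
  | nil => simp
  | cons b L ih =>
    simp only [List.countP_cons]
    cases p b <;> cases q b <;> simp <;> omega

end CyclicLists

section Letters

open FreeGroup

variable {α : Type*}

/-- The formal inverse of a letter of `FreeGroup α`, written `w⁻¹` on the vertices of a Whitehead
graph. -/
def letterInv (w : α × Bool) : α × Bool :=
  (w.1, !w.2)

theorem letterInv_involutive : Function.Involutive (letterInv (α := α)) := fun w => by
  simp [letterInv]

@[simp]
theorem letterInv_letterInv (w : α × Bool) : letterInv (letterInv w) = w :=
  letterInv_involutive w

theorem letterInv_ne (w : α × Bool) : letterInv w ≠ w := fun h => by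
  simpa [letterInv] using congrArg Prod.snd h

theorem fst_eq_fst_iff_eq_or_eq_letterInv {v w : α × Bool} :
    w.1 = v.1 ↔ w = v ∨ w = letterInv v := by
  obtain ⟨i, b⟩ := w
  obtain ⟨j, c⟩ := v
  cases b <;> cases c <;> simp [letterInv]

theorem mk_letterInv (w : α × Bool) : mk [letterInv w] = (mk [w])⁻¹ :=
  (inv_mk (L := [w])).symm

theorem mk_eq_prod_map_mk (L : List (α × Bool)) : mk L = (L.map fun w => mk [w]).prod := by
  induction L with
  | nil => rfl
  | cons a L ih => rw [List.map_cons, List.prod_cons, ← ih, mul_mk, List.singleton_append]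

theorem isReduced_append_letterInv_iff {L : List (α × Bool)} {a w : α × Bool}
    (hL : FreeGroup.IsReduced (L ++ [a])) :
    FreeGroup.IsReduced (L ++ [a] ++ [letterInv w]) ↔ w ≠ a := by
  rw [FreeGroup.IsReduced] at hL ⊢
  rw [List.isChain_append]
  obtain ⟨i, b⟩ := w
  obtain ⟨j, c⟩ := a
  simp only [hL, true_and, List.isChain_singleton]
  by_cases h : i = j
  · cases b <;> cases c <;> simp [letterInv, h]
  · simp [letterInv, h, Ne.symm h]

end Letters

section CyclicallyReduced

open FreeGroup

variable {α : Type*}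

theorem isCyclicallyReduced_append_comm {L₁ L₂ : List (α × Bool)}
    (h : IsCyclicallyReduced (L₁ ++ L₂)) : IsCyclicallyReduced (L₂ ++ L₁) := by
  rcases eq_or_ne L₁ [] with rfl | h₁
  · simpa using h
  rcases eq_or_ne L₂ [] with rfl | h₂
  · simpa using h
  obtain ⟨hred, hcyc⟩ := h
  obtain ⟨hL₁, hL₂, hmid⟩ := List.isChain_append.1 hred
  rw [List.getLast?_append_of_ne_nil _ h₂, List.head?_append_of_ne_nil _ h₁] at hcyc
  refine ⟨List.isChain_append.2 ⟨hL₂, hL₁, hcyc⟩, ?_⟩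
  rwa [List.getLast?_append_of_ne_nil _ h₁, List.head?_append_of_ne_nil _ h₂]

theorem isCyclicallyReduced_rotate {L : List (α × Bool)} (h : IsCyclicallyReduced L) (n : ℕ) :
    IsCyclicallyReduced (L.rotate n) := by
  rw [List.rotate_eq_drop_append_take_mod]
  apply isCyclicallyReduced_append_comm
  rwa [List.take_append_drop]

theorem isCyclicallyReduced_invRev {L : List (α × Bool)} (h : IsCyclicallyReduced L) :
    IsCyclicallyReduced (invRev L) := by
  obtain ⟨hred, hcyc⟩ := h
  constructor
  · rw [invRev, FreeGroup.IsReduced, List.isChain_reverse, List.isChain_map]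
    exact hred.imp fun a b hab hba => by simpa using (hab hba.symm).symm
  · intro a ha b hb hab
    simp only [invRev, List.getLast?_reverse, List.head?_reverse, List.head?_map,
      List.getLast?_map, Option.mem_def, Option.map_eq_some_iff] at ha hb
    obtain ⟨a, ha, rfl⟩ := ha
    obtain ⟨b, hb, rfl⟩ := hb
    simpa using (hcyc b hb a ha hab.symm).symm

theorem isConj_mk_rotate (L : List (α × Bool)) (n : ℕ) : IsConj (mk L) (mk (L.rotate n)) := by
  rw [List.rotate_eq_drop_append_take_mod]
  nth_rewrite 1 [← List.take_append_drop (n % L.length) L]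
  rw [← mul_mk, ← mul_mk]
  exact isConj_iff.2 ⟨(mk (L.take (n % L.length)))⁻¹, by group⟩

theorem norm_pow_le_mul [DecidableEq α] (g : FreeGroup α) (n : ℕ) : (g ^ n).norm ≤ n * g.norm := by
  induction n with
  | zero => simp
  | succ n ih =>
    rw [pow_succ, Nat.succ_mul]
    exact (FreeGroup.norm_mul_le _ _).trans (by omega)

theorem mul_length_reduceCyclically_le_norm_pow [DecidableEq α] (g : FreeGroup α) (n : ℕ) :
    n * (reduceCyclically g.toWord).length ≤ (g ^ n).norm := by
  rw [FreeGroup.norm, toWord_pow, reduceCyclically.reduce_flatten_replicate isReduced_toWord]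
  split_ifs with hn
  · simp [hn]
  · simp only [List.length_append, List.length_flatten, List.map_replicate, List.sum_replicate,
      smul_eq_mul]
    omega

/-- Compare the growth rates of the powers of `g` and of its conjugate `y`. -/
theorem length_reduceCyclically_le_norm_of_isConj [DecidableEq α] {g y : FreeGroup α}
    (h : IsConj y g) : (reduceCyclically g.toWord).length ≤ y.norm := by
  obtain ⟨k, hk⟩ := isConj_iff.1 h
  have hupper : ∀ n : ℕ, (g ^ n).norm ≤ n * y.norm + 2 * k.norm := fun n => by
    rw [← hk, conj_pow]
    have h₁ := FreeGroup.norm_mul_le (k * y ^ n) k⁻¹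
    have h₂ := FreeGroup.norm_mul_le k (y ^ n)
    have h₃ := norm_pow_le_mul y n
    rw [norm_inv_eq] at h₁
    omega
  by_contra! hlt
  have hbound := (mul_length_reduceCyclically_le_norm_pow g (2 * k.norm + 1)).trans (hupper _)
  nlinarith

theorem norm_prod_map_le_countP_add_countP [DecidableEq α] {β : Type*} {f : β → FreeGroup α}
    {p q : β → Bool} (h : ∀ b, (f b).norm ≤ (p b).toNat + (q b).toNat) (L : List β) :
    (L.map f).prod.norm ≤ L.countP p + L.countP q := by
  induction L with
  | nil => simp
  | cons b L ih =>
    have hb := h b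
    have hmul := FreeGroup.norm_mul_le (f b) (L.map f).prod
    rw [List.map_cons, List.prod_cons, List.countP_cons, List.countP_cons]
    cases hp : p b <;> cases hq : q b <;>
      simp only [hp, hq, Bool.toNat_true, Bool.toNat_false, if_true, if_false,
        Bool.false_eq_true] at hb ⊢ <;> omega

end CyclicallyReduced

section CyclicTurns

variable {α : Type*}

/-- The turns of a cyclic word: the pairs `(w, w'⁻¹)` for cyclically consecutive letters `w w'`.
These are the oriented edges of the Whitehead graph. -/
def cyclicTurns (L : List (α × Bool)) : List ((α × Bool) × (α × Bool)) :=
  L.zip ((L.rotate 1).map letterInv)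

theorem cyclicTurns_eq_map_zip (L : List (α × Bool)) :
    cyclicTurns L = (L.zip (L.rotate 1)).map (Prod.map id letterInv) :=
  List.zip_map_right

theorem map_fst_cyclicTurns (L : List (α × Bool)) : (cyclicTurns L).map Prod.fst = L :=
  List.map_fst_zip (by simp)

theorem map_snd_cyclicTurns (L : List (α × Bool)) :
    (cyclicTurns L).map Prod.snd = (L.rotate 1).map letterInv :=
  List.map_snd_zip (by simp)

theorem mk_mem_cyclicTurns {L : List (α × Bool)} {a b : α × Bool} :
    (a, b) ∈ cyclicTurns L ↔ (a, letterInv b) ∈ L.zip (L.rotate 1) := by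
  rw [cyclicTurns_eq_map_zip, List.mem_map]
  constructor
  · rintro ⟨⟨c, d⟩, hmem, h⟩
    obtain ⟨rfl, rfl⟩ := Prod.mk.inj h
    simpa using hmem
  · exact fun h => ⟨_, h, by simp⟩

theorem countP_fst_eq [DecidableEq α] (v : α × Bool) (L : List (α × Bool)) :
    L.countP (fun w => w.1 = v.1) =
      L.countP (fun w => w = v) + L.countP fun w => w = letterInv v := by
  induction L with
  | nil => rfl
  | cons w L ih =>
    simp only [List.countP_cons, decide_eq_true_eq, fst_eq_fst_iff_eq_or_eq_letterInv (w := w), ih]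
    by_cases h : w = v
    · simp only [h, (letterInv_ne v).symm, or_false, if_true, if_false]
      omega
    · simp only [h, false_or, if_false]
      omega

theorem countP_cyclicTurns_le_countP_fst_eq [DecidableEq α] (v : α × Bool)
    (L : List (α × Bool)) :
    (cyclicTurns L).countP (fun r => decide (r.1 = v) || decide (r.2 = v)) ≤
      L.countP fun w => w.1 = v.1 := by
  have hfst : (cyclicTurns L).countP (fun r => r.1 = v) = L.countP fun w => w = v := by
    conv_rhs => rw [← map_fst_cyclicTurns L, List.countP_map]
    rfl
  have hsnd : (cyclicTurns L).countP (fun r => r.2 = v) = L.countP fun w => w = letterInv v := by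
    have hsnd := congrArg (List.countP fun w => decide (w = v)) (map_snd_cyclicTurns L)
    rw [List.countP_map, List.countP_map, (L.rotate_perm 1).countP_eq] at hsnd
    exact hsnd.trans (List.countP_congr fun w _ => by
      simp [letterInv_involutive.eq_iff])
  rw [countP_fst_eq, ← hfst, ← hsnd]
  exact countP_or_le _ _ _

end CyclicTurns

section CyclicWord

open FreeGroup

variable {F ι : Type*} [Group F]

theorem isCyclicallyReduced_cyclicWord (B : FreeGroupBasis ι F) (x : F) :
    IsCyclicallyReduced (cyclicWord B x) := by
  classical
  exact reduceCyclically.isCyclicallyReduced isReduced_toWord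

theorem isConj_mk_cyclicWord (B : FreeGroupBasis ι F) (x : F) :
    IsConj (mk (cyclicWord B x)) (B.repr x) := by
  classical
  refine isConj_iff.2 ⟨mk (reduceCyclically.conjugator (B.repr x).toWord), ?_⟩
  rw [inv_mk, mul_mk, mul_mk, cyclicWord]
  convert mk_toWord (x := B.repr x) using 2
  convert reduceCyclically.conj_conjugator_reduceCyclically _

theorem length_cyclicWord_le_norm [DecidableEq ι] (B : FreeGroupBasis ι F) {x : F}
    {y : FreeGroup ι} (h : IsConj y (B.repr x)) : (cyclicWord B x).length ≤ y.norm := by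
  convert length_reduceCyclically_le_norm_of_isConj h
  rw [cyclicWord]
  congr!

theorem eq_one_of_cyclicWord_eq_nil {B : FreeGroupBasis ι F} {x : F} (h : cyclicWord B x = []) :
    x = 1 := by
  have hconj := isConj_mk_cyclicWord B x
  rwa [h, ← one_eq_mk, isConj_one_right, EmbeddingLike.map_eq_one_iff] at hconj

theorem whiteheadGraph_adj {B : FreeGroupBasis ι F} {x : F} {a b : ι × Bool} :
    (whiteheadGraph B x).Adj a b ↔
      a ≠ b ∧ ((a, b) ∈ cyclicTurns (cyclicWord B x) ∨ (b, a) ∈ cyclicTurns (cyclicWord B x)) := by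
  rw [whiteheadGraph, SimpleGraph.fromRel_adj, mk_mem_cyclicTurns, mk_mem_cyclicTurns]
  rfl

end CyclicWord

section WhiteheadMove

open FreeGroup

variable {ι : Type*}

open Classical in
/-- The power of the multiplier `v` that a Whitehead move along `A` appends to the letter `w`. -/
noncomputable def whiteheadFactor (v : ι × Bool) (A : Set (ι × Bool)) (w : ι × Bool) :
    FreeGroup ι :=
  if w ∈ A then mk [v] else 1

open Classical in
/-- The Whitehead move with multiplier `v` along the set of letters `A`, as an endomorphism of the
free group: it fixes `v`, and for each other letter `w` it appends `v` to `w` if `w ∈ A` and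
prepends `v⁻¹` if `w⁻¹ ∈ A`. -/
noncomputable def whiteheadHom (v : ι × Bool) (A : Set (ι × Bool)) : FreeGroup ι →* FreeGroup ι :=
  FreeGroup.lift fun i => if i = v.1 then of i else
    (whiteheadFactor v A (i, false))⁻¹ * of i * whiteheadFactor v A (i, true)

theorem map_mk_singleton_eq_self {v : ι × Bool} {φ : FreeGroup ι →* FreeGroup ι}
    (h : φ (of v.1) = of v.1) : φ (mk [v]) = mk [v] := by
  obtain ⟨i, b⟩ := v
  cases b with
  | true => exact h
  | false =>
    rw [show ((i, false) : ι × Bool) = letterInv (i, true) from rfl, mk_letterInv,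
      _root_.map_inv]
    exact congrArg _ h

theorem whiteheadHom_of_self (v : ι × Bool) (A : Set (ι × Bool)) :
    whiteheadHom v A (of v.1) = of v.1 := by
  rw [whiteheadHom, lift_apply_of, if_pos rfl]

theorem whiteheadFactor_letterInv (v : ι × Bool) (A : Set (ι × Bool)) (w : ι × Bool) :
    whiteheadFactor (letterInv v) A w = (whiteheadFactor v A w)⁻¹ := by
  unfold whiteheadFactor
  split_ifs
  · exact mk_letterInv v
  · exact inv_one.symm

theorem whiteheadHom_letterInv_comp (v : ι × Bool) (A : Set (ι × Bool)) :
    (whiteheadHom (letterInv v) A).comp (whiteheadHom v A) = MonoidHom.id _ := by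
  have hv : whiteheadHom (letterInv v) A (of v.1) = of v.1 := whiteheadHom_of_self (letterInv v) A
  have hfactor : ∀ w, whiteheadHom (letterInv v) A (whiteheadFactor v A w) =
      whiteheadFactor v A w := by
    intro w
    unfold whiteheadFactor
    split_ifs
    · exact map_mk_singleton_eq_self hv
    · exact _root_.map_one _
  ext i
  rw [MonoidHom.comp_apply, MonoidHom.id_apply]
  by_cases hi : i = v.1
  · rw [hi, whiteheadHom_of_self, hv]
  · have himage : ∀ u : ι × Bool, u.1 = v.1 → whiteheadHom u A (of i) =
        (whiteheadFactor u A (i, false))⁻¹ * of i * whiteheadFactor u A (i, true) := by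
      intro u hu
      rw [whiteheadHom, lift_apply_of, if_neg (hu ▸ hi)]
    rw [himage v rfl, _root_.map_mul, _root_.map_mul, _root_.map_inv, hfactor, hfactor,
      himage (letterInv v) rfl, whiteheadFactor_letterInv, whiteheadFactor_letterInv]
    group

/-- The Whitehead move `whiteheadHom v A` as an automorphism. -/
noncomputable def whiteheadAut (v : ι × Bool) (A : Set (ι × Bool)) : FreeGroup ι ≃* FreeGroup ι :=
  MonoidHom.toMulEquiv (whiteheadHom v A) (whiteheadHom (letterInv v) A)
    (whiteheadHom_letterInv_comp v A)
    (by simpa using whiteheadHom_letterInv_comp (letterInv v) A)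

open Classical in
theorem whiteheadAut_mk_singleton {v : ι × Bool} {A : Set (ι × Bool)} (hv : v ∈ A)
    (hv' : letterInv v ∉ A) (w : ι × Bool) :
    whiteheadAut v A (mk [w]) = (whiteheadFactor v A (letterInv w))⁻¹ *
      ((if w.1 = v.1 then 1 else mk [w]) * whiteheadFactor v A w) := by
  change whiteheadHom v A (mk [w]) = _
  split_ifs with hw
  · have hself := map_mk_singleton_eq_self (whiteheadHom_of_self v A)
    rcases fst_eq_fst_iff_eq_or_eq_letterInv.1 hw with rfl | rfl
    · simp [hself, whiteheadFactor, hv, hv']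
    · rw [mk_letterInv, _root_.map_inv, hself]
      simp [whiteheadFactor, hv, hv', -inv_mk]
  · have himage : whiteheadHom v A (of w.1) = (whiteheadFactor v A (w.1, false))⁻¹ * of w.1 *
        whiteheadFactor v A (w.1, true) := by
      rw [whiteheadHom, lift_apply_of, if_neg hw]
    obtain ⟨i, b⟩ := w
    cases b with
    | true => exact himage.trans (mul_assoc _ _ _)
    | false =>
      rw [show ((i, false) : ι × Bool) = letterInv (i, true) from rfl, mk_letterInv,
        _root_.map_inv, letterInv_letterInv]
      exact (congrArg _ himage).trans (by simp only [of, letterInv, Bool.not_true]; group)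

variable {F : Type*} [Group F]

/-- The basis obtained from `B` by a Whitehead move. -/
noncomputable def whiteheadBasis (B : FreeGroupBasis ι F) (v : ι × Bool) (A : Set (ι × Bool)) :
    FreeGroupBasis ι F :=
  ⟨B.repr.trans (whiteheadAut v A)⟩

open Classical in
theorem isConj_whiteheadBasis_repr (B : FreeGroupBasis ι F) (x : F) {v : ι × Bool}
    {A : Set (ι × Bool)} (hv : v ∈ A) (hv' : letterInv v ∉ A) :
    IsConj (((cyclicTurns (cyclicWord B x)).map fun r => (if r.1.1 = v.1 then 1 else mk [r.1]) *
      whiteheadFactor v A r.1 * (whiteheadFactor v A r.2)⁻¹).prod)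
      ((whiteheadBasis B v A).repr x) := by
  have hmap := MonoidHom.map_isConj (whiteheadAut v A).toMonoidHom (isConj_mk_cyclicWord B x)
  refine IsConj.trans ?_ hmap
  have hturns := isConj_prod_zip_rotate (fun w => (whiteheadFactor v A (letterInv w))⁻¹)
    (fun w => (if w.1 = v.1 then 1 else mk [w]) * whiteheadFactor v A w) (cyclicWord B x)
  simp only [← whiteheadAut_mk_singleton hv hv'] at hturns
  rw [mk_eq_prod_map_mk, map_list_prod, List.map_map, cyclicTurns_eq_map_zip, List.map_map]
  exact hturns

open Classical in
theorem length_cyclicWord_whiteheadBasis_add_le (B : FreeGroupBasis ι F) (x : F) {v : ι × Bool}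
    {A : Set (ι × Bool)} (hv : v ∈ A) (hv' : letterInv v ∉ A) :
    (cyclicWord (whiteheadBasis B v A) x).length +
        (cyclicWord B x).countP (fun w => w.1 = v.1) ≤
      (cyclicWord B x).length +
        (cyclicTurns (cyclicWord B x)).countP fun r => ¬ (r.1 ∈ A ↔ r.2 ∈ A) := by
  have hnorm : ∀ r : (ι × Bool) × (ι × Bool),
      ((if r.1.1 = v.1 then 1 else mk [r.1]) * whiteheadFactor v A r.1 *
        (whiteheadFactor v A r.2)⁻¹).norm ≤
      (decide ¬ (r.1.1 = v.1)).toNat + (decide ¬ (r.1 ∈ A ↔ r.2 ∈ A)).toNat := by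
    intro r
    rw [mul_assoc]
    refine (FreeGroup.norm_mul_le _ _).trans (Nat.add_le_add ?_ ?_)
    · split_ifs with h
      · simp [h]
      · simpa [h] using norm_mk_le (L₁ := [r.1])
    · have hv₁ : (mk [v]).norm ≤ 1 := norm_mk_le
      by_cases h₁ : r.1 ∈ A <;> by_cases h₂ : r.2 ∈ A <;>
        simp [whiteheadFactor, h₁, h₂, hv₁, -inv_mk]
  have hlength := (length_cyclicWord_le_norm _ (isConj_whiteheadBasis_repr B x hv hv')).trans
    (norm_prod_map_le_countP_add_countP hnorm _)
  have hfst : (cyclicTurns (cyclicWord B x)).countP (fun r => decide ¬ (r.1.1 = v.1)) =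
      (cyclicWord B x).countP fun w => ¬ (w.1 = v.1) := by
    conv_rhs => rw [← map_fst_cyclicTurns (cyclicWord B x), List.countP_map]
    rfl
  have hsplit := (cyclicWord B x).length_eq_countP_add_countP fun w => decide (w.1 = v.1)
  simp only [decide_eq_true_eq] at hsplit
  omega

theorem exists_length_cyclicWord_lt {B : FreeGroupBasis ι F} {x : F} {v : ι × Bool}
    {A : Set (ι × Bool)} (hv : v ∈ A) (hv' : letterInv v ∉ A)
    (hsep : ∀ r ∈ cyclicTurns (cyclicWord B x), ¬ (r.1 ∈ A ↔ r.2 ∈ A) → r.1 = v ∨ r.2 = v)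
    (hturn : ∃ r ∈ cyclicTurns (cyclicWord B x), (r.1 = v ∨ r.2 = v) ∧ (r.1 ∈ A ↔ r.2 ∈ A)) :
    ∃ B' : FreeGroupBasis ι F, (cyclicWord B' x).length < (cyclicWord B x).length := by
  classical
  refine ⟨whiteheadBasis B v A, ?_⟩
  have hlength := length_cyclicWord_whiteheadBasis_add_le B x hv hv'
  have hcount := countP_cyclicTurns_le_countP_fst_eq v (cyclicWord B x)
  have hlt : (cyclicTurns (cyclicWord B x)).countP (fun r => ¬ (r.1 ∈ A ↔ r.2 ∈ A)) <
      (cyclicTurns (cyclicWord B x)).countP fun r => decide (r.1 = v) || decide (r.2 = v) := by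
    apply countP_lt_countP
    · simpa using hsep
    · simpa using hturn
  omega

end WhiteheadMove

section FreeProduct

variable {F : Type*} [Group F]

theorem isInternalFreeProduct_of_comp_subtype {F₁ F₂ : Subgroup F} (hsup : F₁ ⊔ F₂ = ⊤)
    {ψ : F →* Monoid.Coprod F₁ F₂} (h₁ : ψ.comp F₁.subtype = Monoid.Coprod.inl)
    (h₂ : ψ.comp F₂.subtype = Monoid.Coprod.inr) : IsInternalFreeProduct F₁ F₂ := by
  constructor
  · have hψ : ψ.comp (Monoid.Coprod.lift F₁.subtype F₂.subtype) = MonoidHom.id _ :=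
      Monoid.Coprod.hom_ext (by rw [MonoidHom.comp_assoc, Monoid.Coprod.lift_comp_inl, h₁]; rfl)
        (by rw [MonoidHom.comp_assoc, Monoid.Coprod.lift_comp_inr, h₂]; rfl)
    exact Function.LeftInverse.injective (g := ψ) fun y => DFunLike.congr_fun hψ y
  · rwa [← MonoidHom.range_eq_top, Monoid.Coprod.range_lift, Subgroup.range_subtype,
      Subgroup.range_subtype]

theorem IsInternalFreeProduct.sup_eq_top {F₁ F₂ : Subgroup F} (h : IsInternalFreeProduct F₁ F₂) :
    F₁ ⊔ F₂ = ⊤ := by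
  rw [← MonoidHom.range_eq_top.2 h.2, Monoid.Coprod.range_lift, Subgroup.range_subtype,
    Subgroup.range_subtype]

theorem comp_subtype_closure_eq {M : Type*} [Group M] {ψ : F →* M} {S : Set F}
    {φ : Subgroup.closure S →* M}
    (h : ∀ y (hy : y ∈ S), ψ y = φ ⟨y, Subgroup.subset_closure hy⟩) :
    ψ.comp (Subgroup.closure S).subtype = φ :=
  MonoidHom.eq_of_eqOn_dense Subgroup.closure_closure_coe_preimage fun y hy => h y hy

variable {ι : Type*}

theorem closure_range_freeGroupBasis (B : FreeGroupBasis ι F) :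
    Subgroup.closure (Set.range B) = ⊤ := by
  have hrange : Set.range B = B.repr.symm.toMonoidHom '' Set.range FreeGroup.of := by
    rw [← Set.range_comp]; rfl
  rw [hrange, ← MonoidHom.map_closure, FreeGroup.closure_range_of, ← MonoidHom.range_eq_map]
  exact MonoidHom.range_eq_top.2 B.repr.symm.surjective

theorem isInternalFreeProduct_closure_image (B : FreeGroupBasis ι F) (S : Set ι) :
    IsInternalFreeProduct (Subgroup.closure (B '' S)) (Subgroup.closure (B '' Sᶜ)) := by
  classical
  let ψ : F →* Monoid.Coprod (Subgroup.closure (B '' S)) (Subgroup.closure (B '' Sᶜ)) :=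
    B.lift fun i =>
      if h : i ∈ S then Monoid.Coprod.inl ⟨B i, Subgroup.subset_closure ⟨i, h, rfl⟩⟩
      else Monoid.Coprod.inr ⟨B i, Subgroup.subset_closure ⟨i, h, rfl⟩⟩
  refine isInternalFreeProduct_of_comp_subtype (ψ := ψ) ?_ (comp_subtype_closure_eq ?_)
    (comp_subtype_closure_eq ?_)
  · rw [← Subgroup.closure_union, ← Set.image_union, Set.union_compl_self, Set.image_univ,
      closure_range_freeGroupBasis]
  · rintro _ ⟨i, hi, rfl⟩
    simp [ψ, hi]
  · rintro _ ⟨i, hi, rfl⟩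
    simp [ψ, show i ∉ S from hi]

theorem closure_image_ne_bot (B : FreeGroupBasis ι F) {S : Set ι} (hS : S.Nonempty) :
    Subgroup.closure (B '' S) ≠ ⊥ := fun h => by
  obtain ⟨i, hi⟩ := hS
  have hBi : B i = 1 := by
    rw [← Subgroup.mem_bot, ← h]
    exact Subgroup.subset_closure ⟨i, hi, rfl⟩
  apply FreeGroup.of_ne_one i
  rw [← B.repr_apply_coe, hBi, map_one]

theorem mk_mem_closure_image_of {S : Set ι} {L : List (ι × Bool)} (h : ∀ w ∈ L, w.1 ∈ S) :
    FreeGroup.mk L ∈ Subgroup.closure (FreeGroup.of '' S) := by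
  rw [mk_eq_prod_map_mk]
  refine Subgroup.list_prod_mem _ fun y hy => ?_
  obtain ⟨⟨i, b⟩, hw, rfl⟩ := List.mem_map.1 hy
  have hi : FreeGroup.of i ∈ Subgroup.closure (FreeGroup.of '' S) :=
    Subgroup.subset_closure ⟨i, h _ hw, rfl⟩
  cases b with
  | true => exact hi
  | false => exact inv_mem hi

theorem exists_conj_mem_closure_image (B : FreeGroupBasis ι F) {x : F} {S : Set ι}
    (h : ∀ w ∈ cyclicWord B x, w.1 ∈ S) :
    ∃ g : F, g * x * g⁻¹ ∈ Subgroup.closure (B '' S) := by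
  have hmem := Subgroup.mem_map_of_mem B.repr.symm.toMonoidHom (mk_mem_closure_image_of h)
  have himage : B.repr.symm.toMonoidHom '' (FreeGroup.of '' S) = B '' S := Set.image_image _ _ _
  rw [MonoidHom.map_closure, himage] at hmem
  obtain ⟨k, hk⟩ := isConj_iff.1
    (B.repr.symm.toMonoidHom.map_isConj (isConj_mk_cyclicWord B x).symm)
  refine ⟨k, ?_⟩
  rw [← hk] at hmem
  simpa using hmem

theorem isSeparableSet_of_partition (B : FreeGroupBasis ι F) {x : F} {S : Set ι}
    (hS : S.Nonempty) (hS' : Sᶜ.Nonempty)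
    (h : (∀ w ∈ cyclicWord B x, w.1 ∈ S) ∨ ∀ w ∈ cyclicWord B x, w.1 ∉ S) :
    IsSeparableSet {x} := by
  refine ⟨_, _, closure_image_ne_bot B hS, closure_image_ne_bot B hS',
    isInternalFreeProduct_closure_image B S, fun a ha => ?_⟩
  obtain rfl := Finset.mem_singleton.1 ha
  exact h.imp (exists_conj_mem_closure_image B) (exists_conj_mem_closure_image B)

theorem isSeparableSet_of_forall_fst_ne (B : FreeGroupBasis ι F) {x : F}
    (hx : x = 1 → IsEmpty (F ≃* Multiplicative ℤ)) {i : ι}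
    (h : ∀ w ∈ cyclicWord B x, w.1 ≠ i) : IsSeparableSet {x} := by
  rcases Set.eq_empty_or_nonempty ({i}ᶜ : Set ι) with hempty | hne
  · have huniq : ∀ j, j = i := fun j => by
      by_contra hj
      exact hempty.subset hj
    have hnil : cyclicWord B x = [] :=
      List.eq_nil_iff_forall_not_mem.2 fun w hw => h w hw (huniq w.1)
    have : Unique ι := ⟨⟨i⟩, huniq⟩
    exact ((hx (eq_one_of_cyclicWord_eq_nil hnil)).false
      (B.repr.trans FreeGroup.mulEquivIntOfUnique)).elim
  · exact isSeparableSet_of_partition B (Set.singleton_nonempty i) hne (Or.inr h)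

end FreeProduct

section CutVertex

variable {V : Type*} {G : SimpleGraph V}

theorem apply_eq_of_preconnected {γ : Type*} (hG : G.Preconnected) {d : V → γ}
    (hd : ∀ a b, G.Adj a b → d a = d b) (a b : V) : d a = d b := by
  obtain ⟨p⟩ := hG a b
  induction p with
  | nil => rfl
  | cons h _ ih => exact (hd _ _ h).trans ih

theorem IsCutVertex.not_preconnected_induce_compl {v : V} (hv : IsCutVertex G v) :
    ¬ (G.induce {v}ᶜ).Preconnected := fun h => by
  have hcompl : Cardinal.mk (G.induce {v}ᶜ).ConnectedComponent ≤ 1 :=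
    Cardinal.le_one_iff_subsingleton.2 h.subsingleton_connectedComponent
  have hwhole : 1 ≤ Cardinal.mk G.ConnectedComponent :=
    Cardinal.one_le_iff_ne_zero.2 (Cardinal.mk_ne_zero_iff.2 ⟨G.connectedComponentMk v⟩)
  exact hv.not_ge (hcompl.trans hwhole)

theorem preconnected_induce_compl_of_not_isCutVertex (hG : G.Preconnected) {v : V}
    (hv : ¬ IsCutVertex G v) : (G.induce {v}ᶜ).Preconnected := by
  have hcard : Cardinal.mk (G.induce {v}ᶜ).ConnectedComponent ≤ 1 :=
    (not_lt.1 hv).trans (Cardinal.le_one_iff_subsingleton.2 hG.subsingleton_connectedComponent)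
  have := Cardinal.le_one_iff_subsingleton.1 hcard
  exact fun a b => SimpleGraph.ConnectedComponent.exact (Subsingleton.elim _ _)

theorem exists_isolated_set_of_not_preconnected_induce_compl (hG : G.Preconnected) {u v : V}
    (huv : u ≠ v) (hv : ¬ (G.induce {v}ᶜ).Preconnected) :
    ∃ C : Set V, u ∉ C ∧ (∃ p ∈ C, G.Adj p v) ∧
      ∀ p ∈ C, ∀ q, G.Adj p q → q ≠ v → q ∈ C := by
  let u' : ({v}ᶜ : Set V) := ⟨u, huv⟩
  obtain ⟨r, hr⟩ : ∃ r, ¬ (G.induce {v}ᶜ).Reachable u' r := by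
    by_contra! hall
    exact hv fun p q => (hall p).symm.trans (hall q)
  let C : Set V := {w | ∃ h : w ≠ v, ¬ (G.induce {v}ᶜ).Reachable u' ⟨w, h⟩}
  have hvC : v ∉ C := fun h => h.1 rfl
  have hC : ∀ p ∈ C, ∀ q, G.Adj p q → q ≠ v → q ∈ C := by
    rintro p ⟨_, hpC⟩ q hpq hq
    exact ⟨hq, fun hreach => hpC (hreach.trans
      (SimpleGraph.Adj.reachable (SimpleGraph.comap_adj.2 hpq.symm)))⟩
  refine ⟨C, fun h => h.2 (SimpleGraph.Reachable.refl u'), ?_, hC⟩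
  obtain ⟨p⟩ := hG r.1 v
  obtain ⟨d, -, hdC, hdC'⟩ := p.exists_boundary_dart C ⟨r.2, hr⟩ hvC
  have hdv : d.snd = v := by
    by_contra hne
    exact hdC' (hC _ hdC _ d.adj hne)
  exact ⟨d.fst, hdC, hdv ▸ d.adj⟩

end CutVertex

section ShortestBasis

variable {F ι : Type*} [Group F] {B : FreeGroupBasis ι F} {x : F}

theorem exists_mem_cyclicTurns_of_fst_eq {L : List (ι × Bool)} {v w : ι × Bool} (hw : w ∈ L)
    (hwv : w.1 = v.1) : ∃ r ∈ cyclicTurns L, r.1 = v ∨ r.2 = v := by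
  rcases fst_eq_fst_iff_eq_or_eq_letterInv.1 hwv with rfl | rfl
  · rw [← map_fst_cyclicTurns L, List.mem_map] at hw
    obtain ⟨r, hr, hrw⟩ := hw
    exact ⟨r, hr, Or.inl hrw⟩
  · have hv : v ∈ (cyclicTurns L).map Prod.snd := by
      rw [map_snd_cyclicTurns]
      exact List.mem_map.2 ⟨_, List.mem_rotate.2 hw, letterInv_letterInv v⟩
    obtain ⟨r, hr, hrv⟩ := List.mem_map.1 hv
    exact ⟨r, hr, Or.inr hrv⟩

theorem isSeparableSet_of_turns_iff_of_letterInv_mem {C : Set (ι × Bool)}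
    (hC : ∀ r ∈ cyclicTurns (cyclicWord B x), r.1 ∈ C ↔ r.2 ∈ C)
    (hinv : ∀ v ∈ C, letterInv v ∈ C) (hne : C.Nonempty) (hne' : Cᶜ.Nonempty) :
    IsSeparableSet {x} := by
  have hinv_iff : ∀ v, letterInv v ∈ C ↔ v ∈ C := fun v =>
    ⟨fun h => letterInv_letterInv v ▸ hinv _ h, hinv v⟩
  have hfst : ∀ w : ι × Bool, (w.1, true) ∈ C ↔ w ∈ C := by
    rintro ⟨i, b⟩
    cases b with
    | true => rfl
    | false => exact hinv_iff (i, false)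
  obtain ⟨a, ha⟩ := hne
  obtain ⟨b, hb⟩ := hne'
  refine isSeparableSet_of_partition B (S := {i | (i, true) ∈ C}) ⟨a.1, (hfst a).2 ha⟩
    ⟨b.1, fun h => hb ((hfst b).1 h)⟩ ?_
  simp only [Set.mem_ofPred_eq, hfst]
  refine forall_mem_or_forall_not_of_zip_rotate fun u v huv => ?_
  rw [← hinv_iff v]
  exact hC (u, letterInv v) (mk_mem_cyclicTurns.2 (by rwa [letterInv_letterInv]))

theorem isSeparableSet_or_exists_length_lt_of_not_preconnected
    (hx : x = 1 → IsEmpty (F ≃* Multiplicative ℤ)) (hG : ¬ (whiteheadGraph B x).Preconnected) :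
    IsSeparableSet {x} ∨
      ∃ B' : FreeGroupBasis ι F, (cyclicWord B' x).length < (cyclicWord B x).length := by
  obtain ⟨a, b, hab⟩ : ∃ a b, ¬ (whiteheadGraph B x).Reachable a b := by
    by_contra! hall
    exact hG hall
  let C : Set (ι × Bool) := {w | (whiteheadGraph B x).Reachable a w}
  have hC : ∀ r ∈ cyclicTurns (cyclicWord B x), r.1 ∈ C ↔ r.2 ∈ C := by
    intro r hr
    rcases eq_or_ne r.1 r.2 with heq | hne
    · rw [heq]
    · have hadj := (whiteheadGraph_adj.2 ⟨hne, Or.inl hr⟩).reachable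
      exact ⟨fun h => h.trans hadj, fun h => h.trans hadj.symm⟩
  by_cases hinv : ∀ v ∈ C, letterInv v ∈ C
  · exact Or.inl (isSeparableSet_of_turns_iff_of_letterInv_mem hC hinv
      ⟨a, SimpleGraph.Reachable.refl a⟩ ⟨b, hab⟩)
  · push Not at hinv
    obtain ⟨v, hv, hv'⟩ := hinv
    by_cases hocc : ∀ w ∈ cyclicWord B x, w.1 ≠ v.1
    · exact Or.inl (isSeparableSet_of_forall_fst_ne B hx hocc)
    · push Not at hocc
      obtain ⟨w, hw, hwv⟩ := hocc
      obtain ⟨r, hr, hrv⟩ := exists_mem_cyclicTurns_of_fst_eq hw hwv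
      exact Or.inr (exists_length_cyclicWord_lt hv hv' (fun r hr hsep => absurd (hC r hr) hsep)
        ⟨r, hr, hrv, hC r hr⟩)

theorem exists_length_cyclicWord_lt_of_isCutVertex (hG : (whiteheadGraph B x).Preconnected)
    {v : ι × Bool} (hv : IsCutVertex (whiteheadGraph B x) v) :
    ∃ B' : FreeGroupBasis ι F, (cyclicWord B' x).length < (cyclicWord B x).length := by
  obtain ⟨C, hvC, ⟨p, hp, hpv⟩, hC⟩ :=
    exists_isolated_set_of_not_preconnected_induce_compl hG (letterInv_ne v)
      hv.not_preconnected_induce_compl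
  refine exists_length_cyclicWord_lt (A := insert v C) (Set.mem_insert v C)
    (by simp [letterInv_ne, hvC]) ?_ ?_
  · intro r hr hsep
    by_contra! hrv
    have hne : r.1 ≠ r.2 := fun h => hsep (by rw [h])
    have hadj := whiteheadGraph_adj.2 ⟨hne, Or.inl hr⟩
    simp only [Set.mem_insert_iff, hrv.1, hrv.2, false_or] at hsep
    exact hsep ⟨fun h => hC _ h _ hadj hrv.2, fun h => hC _ h _ hadj.symm hrv.1⟩
  · rcases (whiteheadGraph_adj.1 hpv).2 with hr | hr
    · exact ⟨_, hr, by simp, by simp [hp]⟩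
    · exact ⟨_, hr, by simp, by simp [hp]⟩

end ShortestBasis

section AlmostInvariant

open Filter

variable {G γ : Type*} [Group G]

/-- The elements `s` of `G` for which `f` is almost invariant under right translation by `s`: the
functions `g ↦ f (g * s)` and `f` differ at finitely many points only. A set is encoded by its
membership predicate. -/
def almostStabilizer (f : G → γ) : Subgroup G where
  carrier := {s | ∀ᶠ g in cofinite, f (g * s) = f g}
  one_mem' := by simp
  mul_mem' {a b} ha hb := by
    filter_upwards [ha, (mul_left_injective a).tendsto_cofinite.eventually hb] with g hga hgb
    rw [← mul_assoc, hgb, hga]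
  inv_mem' {a} ha := by
    filter_upwards [(mul_left_injective a⁻¹).tendsto_cofinite.eventually ha] with g hg
    rw [← hg, inv_mul_cancel_right]

theorem mem_almostStabilizer {f : G → γ} {s : G} :
    s ∈ almostStabilizer f ↔ ∀ᶠ g in cofinite, f (g * s) = f g :=
  Iff.rfl

theorem almostStabilizer_congr {f f' : G → γ} (h : f =ᶠ[cofinite] f') :
    almostStabilizer f = almostStabilizer f' := by
  have hle : ∀ {f f' : G → γ}, f =ᶠ[cofinite] f' →
      almostStabilizer f ≤ almostStabilizer f' := fun {f f'} h s hs => by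
    filter_upwards [mem_almostStabilizer.1 hs, h,
      (mul_left_injective s).tendsto_cofinite.eventually h] with g hg h₁ h₂
    rw [← h₂, hg, h₁]
  exact (hle h).antisymm (hle h.symm)

theorem le_almostStabilizer {f : G → γ} {H : Subgroup G} (h : ∀ g, ∀ s ∈ H, f (g * s) = f g) :
    H ≤ almostStabilizer f := fun s hs =>
  mem_almostStabilizer.2 (Eventually.of_forall fun g => h g s hs)

theorem almostStabilizer_comp_mulEquiv {G' : Type*} [Group G'] (e : G' ≃* G) (f : G → γ) :
    almostStabilizer (f ∘ e) = (almostStabilizer f).comap e.toMonoidHom := by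
  ext s
  have hmap : map e cofinite = cofinite :=
    le_antisymm e.injective.tendsto_cofinite e.surjective.le_map_cofinite
  simp [mem_almostStabilizer, ← hmap]

theorem eventuallyConst_mul_zpow_of_almostStabilizer_eq_top {f f' : G → γ}
    (hf : almostStabilizer f = ⊤) (hff' : f =ᶠ[cofinite] f') {a y : G}
    (ha : ¬ IsOfFinOrder a) (hf' : ∀ (g : G) (n : ℤ), f' (g * a ^ n) = f' g) (hay : IsConj a y)
    (g : G) : EventuallyConst (fun n : ℤ => f (g * y ^ n)) cofinite := by
  obtain ⟨k, rfl⟩ := isConj_iff.1 hay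
  have htendsto : Tendsto (fun n : ℤ => g * k * a ^ n) cofinite cofinite :=
    ((mul_right_injective (g * k)).comp
      (injective_zpow_iff_not_isOfFinOrder.2 ha)).tendsto_cofinite
  have hk : k⁻¹ ∈ almostStabilizer f := hf ▸ Subgroup.mem_top _
  refine (EventuallyConst.const (f' (g * k))).congr ?_
  filter_upwards [htendsto.eventually (mem_almostStabilizer.1 hk), htendsto.eventually hff']
    with n hn hn'
  rw [conj_zpow, ← mul_assoc, ← mul_assoc, hn, hn', hf']

theorem not_eventuallyConst_mem_cofinite {β : Type*} {P : Set β} (h₁ : P.Infinite)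
    (h₂ : Pᶜ.Infinite) : ¬ EventuallyConst (· ∈ P) cofinite := fun h => by
  rcases eventuallyConst_pred.1 h with h | h
  · exact h₂ (eventually_cofinite.1 h)
  · exact h₁ (by simpa using eventually_cofinite.1 h)

end AlmostInvariant

section AlmostInvariantSet

open Filter Monoid
open scoped Pointwise symmDiff

variable {F : Type*} [Group F] {F₁ F₂ : Subgroup F}

/-- The action of `F₁ ∗ F₂` on the subsets of `F` in which `F₁` acts by left translation and `F₂`
by left translation conjugated by the symmetric difference with `{1}`. -/
def twistedTranslation (F₁ F₂ : Subgroup F) : Coprod F₁ F₂ →* Equiv.Perm (Set F) :=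
  Coprod.lift ((MulAction.toPermHom F (Set F)).comp F₁.subtype)
    (((MulAut.conj (symmDiff_right_involutive ({1} : Set F)).toPerm).toMonoidHom.comp
      (MulAction.toPermHom F (Set F))).comp F₂.subtype)

theorem twistedTranslation_inl (s : F₁) (E : Set F) :
    twistedTranslation F₁ F₂ (Coprod.inl s) E = (s : F) • E := by
  simp [twistedTranslation]

theorem twistedTranslation_inr (s : F₂) (E : Set F) :
    twistedTranslation F₁ F₂ (Coprod.inr s) E = {1} ∆ ((s : F) • ({1} ∆ E)) := by
  simp only [twistedTranslation, Coprod.lift_apply_inr]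
  rfl

theorem twistedTranslation_symmDiff (y : Coprod F₁ F₂) (E E' : Set F) :
    twistedTranslation F₁ F₂ y E ∆ twistedTranslation F₁ F₂ y E' =
      Coprod.lift F₁.subtype F₂.subtype y • (E ∆ E') := by
  induction y using Coprod.induction_on generalizing E E' with
  | inl s =>
    rw [twistedTranslation_inl, twistedTranslation_inl, ← Set.smul_set_symmDiff]
    simp
  | inr s =>
    rw [twistedTranslation_inr, twistedTranslation_inr, symmDiff_symmDiff_symmDiff_comm,
      symmDiff_self, bot_symmDiff, ← Set.smul_set_symmDiff, symmDiff_symmDiff_symmDiff_comm,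
      symmDiff_self, bot_symmDiff]
    simp
  | mul a b ha hb =>
    rw [map_mul, Equiv.Perm.mul_apply, Equiv.Perm.mul_apply, ha, hb, map_mul, mul_smul]

/-- The witness is the set of elements whose normal form begins in `F₂`. To avoid normal forms, it
is obtained as the set of those `g` for which the twisted translation by `g` moves `∅` to a set
containing `1`. -/
theorem IsInternalFreeProduct.exists_invariant_set (h : IsInternalFreeProduct F₁ F₂) :
    ∃ P : Set F, 1 ∉ P ∧ (∀ g, ∀ s ∈ F₁, g * s ∈ P ↔ g ∈ P) ∧
      ∀ g, ∀ s ∈ F₂, g * s ∈ insert 1 P ↔ g ∈ insert 1 P := by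
  let e : Coprod F₁ F₂ ≃* F := MulEquiv.ofBijective _ h
  let Φ : F →* Equiv.Perm (Set F) := (twistedTranslation F₁ F₂).comp e.symm.toMonoidHom
  have hinl : ∀ s ∈ F₁, Φ s ∅ = ∅ := fun s hs => by
    have he : e.symm s = Coprod.inl ⟨s, hs⟩ := e.symm_apply_eq.2 rfl
    simp [Φ, he, twistedTranslation_inl]
  have hinr : ∀ s ∈ F₂, Φ s {1} = {1} := fun s hs => by
    have he : e.symm s = Coprod.inr ⟨s, hs⟩ := e.symm_apply_eq.2 rfl
    simp [Φ, he, twistedTranslation_inr]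
  let P : Set F := {g | 1 ∈ Φ g ∅}
  have hone : 1 ∉ P := by simp [P]
  have hinsert : ∀ g, g ∈ insert 1 P ↔ 1 ∈ Φ g {1} := fun g => by
    have hsymm : Φ g {1} ∆ Φ g ∅ = {g} := by
      have hlift : Coprod.lift F₁.subtype F₂.subtype (e.symm g) = g := e.apply_symm_apply g
      refine (twistedTranslation_symmDiff (e.symm g) {1} ∅).trans ?_
      rw [hlift, ← Set.bot_eq_empty, symmDiff_bot, Set.smul_set_singleton, smul_eq_mul, mul_one]
    have hmem := Set.ext_iff.1 hsymm 1
    rw [Set.mem_symmDiff, Set.mem_singleton_iff] at hmem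
    have hP : g ∈ P ↔ 1 ∈ Φ g ∅ := Iff.rfl
    rw [Set.mem_insert_iff]
    by_cases hg : g = 1
    · subst hg; tauto
    · have := Ne.symm hg; tauto
  refine ⟨P, hone, fun g s hs => ?_, fun g s hs => ?_⟩
  · change 1 ∈ Φ (g * s) ∅ ↔ 1 ∈ Φ g ∅
    rw [map_mul, Equiv.Perm.mul_apply, hinl s hs]
  · rw [hinsert, hinsert, map_mul, Equiv.Perm.mul_apply, hinr s hs]

theorem infinite_coe_of_ne_bot [IsMulTorsionFree F] {H : Subgroup F} (h : H ≠ ⊥) :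
    (H : Set F).Infinite := by
  obtain ⟨a, ha, ha₁⟩ := H.bot_or_exists_ne_one.resolve_left h
  exact Set.infinite_of_injective_forall_mem
    (injective_zpow_iff_not_isOfFinOrder.2 (not_isOfFinOrder_of_isMulTorsionFree ha₁))
    fun n : ℤ => H.zpow_mem ha n

theorem IsSeparableSet.exists_almostInvariant [IsMulTorsionFree F] {x : F}
    (h : IsSeparableSet {x}) (hx : x ≠ 1) :
    ∃ P : F → Prop, almostStabilizer P = ⊤ ∧ ¬ EventuallyConst P cofinite ∧
      ∀ y, IsConj x y → ∀ g, EventuallyConst (fun n : ℤ => P (g * y ^ n)) cofinite := by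
  obtain ⟨F₁, F₂, hF₁, hF₂, hF, hconj⟩ := h
  obtain ⟨P, hone, hP₁, hP₂⟩ := hF.exists_invariant_set
  have hinsert : (· ∈ P) =ᶠ[cofinite] (· ∈ insert 1 P) := by
    filter_upwards [(Set.finite_singleton (1 : F)).compl_mem_cofinite] with g hg
    simp [show g ≠ 1 from hg]
  have htop : almostStabilizer (· ∈ P) = ⊤ := by
    rw [eq_top_iff, ← hF.sup_eq_top, sup_le_iff]
    refine ⟨le_almostStabilizer fun g s hs => propext (hP₁ g s hs), ?_⟩
    rw [almostStabilizer_congr hinsert]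
    exact le_almostStabilizer fun g s hs => propext (hP₂ g s hs)
  refine ⟨(· ∈ P), htop, not_eventuallyConst_mem_cofinite ?_ ?_, fun y hy => ?_⟩
  · refine ((infinite_coe_of_ne_bot hF₂).sdiff (Set.finite_singleton 1)).mono fun s hs => ?_
    have hs' := (hP₂ 1 s hs.1).2 (Set.mem_insert 1 P)
    rw [one_mul] at hs'
    exact hs'.resolve_left hs.2
  · refine (infinite_coe_of_ne_bot hF₁).mono fun s hs => ?_
    rw [Set.mem_compl_iff, ← one_mul s, hP₁ 1 s hs]
    exact hone
  · rcases hconj x (Finset.mem_singleton_self x) with ⟨k, hk⟩ | ⟨k, hk⟩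
    all_goals
      have hfin : ¬ IsOfFinOrder (k * x * k⁻¹) :=
        not_isOfFinOrder_of_isMulTorsionFree (mt conj_eq_one_iff.1 hx)
      have hky : IsConj (k * x * k⁻¹) y := (isConj_iff.2 ⟨k, rfl⟩ : IsConj x _).symm.trans hy
    · exact eventuallyConst_mul_zpow_of_almostStabilizer_eq_top htop EventuallyEq.rfl hfin
        (fun g n => propext (hP₁ g _ (F₁.zpow_mem hk n))) hky
    · exact eventuallyConst_mul_zpow_of_almostStabilizer_eq_top htop hinsert hfin
        (fun g n => propext (hP₂ g _ (F₂.zpow_mem hk n))) hky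

end AlmostInvariantSet

section Cones

open FreeGroup Filter Topology

variable {α γ : Type*}

/-- The cone in the Cayley tree of a free group on the far side of the vertex `L`: the elements
whose reduced word starts with `L`. -/
def wordCone [DecidableEq α] (L : List (α × Bool)) : Set (FreeGroup α) :=
  {g | L <+: g.toWord}

section Limits

variable [DecidableEq α] {f : FreeGroup α → γ} {L R : List (α × Bool)}

theorem wordCone_eq_empty (hL : ¬ FreeGroup.IsReduced L) : wordCone L = ∅ :=
  Set.eq_empty_of_forall_notMem fun _ hg => hL (isReduced_toWord.infix hg.isInfix)

theorem wordCone_subset_insert_iUnion (L : List (α × Bool)) :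
    wordCone L ⊆ insert (mk L) (⋃ a, wordCone (L ++ [a])) := by
  rintro g ⟨T, hT⟩
  cases T with
  | nil => exact Or.inl (by rw [← mk_toWord (x := g), ← hT, List.append_nil])
  | cons a T => exact Or.inr (Set.mem_iUnion.2 ⟨a, T, by rw [← hT]; simp⟩)

theorem mk_mul_mk_pow_mem_wordCone {b : α × Bool} (hR : IsCyclicallyReduced R)
    (hb : R.head? = some b) (hL : FreeGroup.IsReduced (L ++ [b])) {n : ℕ} (hn : n ≠ 0) :
    mk L * mk R ^ n ∈ wordCone (L ++ [b]) := by
  obtain ⟨T, hT⟩ : ∃ T, (List.replicate n R).flatten = b :: T :=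
    List.head?_eq_some_iff.1 (by rw [List.head?_flatten_replicate hn, hb])
  have hred : FreeGroup.IsReduced (L ++ [b] ++ T) :=
    IsReduced.append_overlap hL (by simpa [hT] using (hR.flatten_replicate n).isReduced) (by simp)
  refine ⟨T, ?_⟩
  have happend : L ++ b :: T = L ++ [b] ++ T := by simp
  rw [pow_mk, mul_mk, toWord_mk, hT, happend, hred.reduce_eq]

theorem tendsto_mk_mul_mk_pow {b : α × Bool} (hR : IsCyclicallyReduced R)
    (hb : R.head? = some b) (hL : FreeGroup.IsReduced (L ++ [b])) :
    Tendsto (fun n : ℕ => mk L * mk R ^ n) atTop (cofinite ⊓ 𝓟 (wordCone (L ++ [b]))) := by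
  have hne : mk R ≠ 1 := fun h => by
    have hnil : R = [] := by rw [← hR.isReduced.reduce_eq, ← toWord_mk, h, toWord_one]
    simp [hnil] at hb
  have hinj : Function.Injective fun n : ℕ => mk L * mk R ^ n :=
    (mul_right_injective (mk L)).comp
      (injective_pow_iff_not_isOfFinOrder.2 (not_isOfFinOrder_of_isMulTorsionFree hne))
  rw [tendsto_inf, tendsto_principal]
  refine ⟨Nat.cofinite_eq_atTop ▸ hinj.tendsto_cofinite, ?_⟩
  filter_upwards [eventually_ne_atTop 0] with n hn
  exact mk_mul_mk_pow_mem_wordCone hR hb hL hn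

theorem eq_of_tendsto_wordCone {b : α × Bool} {c e : γ} (hR : IsCyclicallyReduced R)
    (hb : R.head? = some b) (hL : FreeGroup.IsReduced (L ++ [b]))
    (hc : Tendsto f (cofinite ⊓ 𝓟 (wordCone (L ++ [b]))) (pure c))
    (he : Tendsto (fun n : ℤ => f (mk L * mk R ^ n)) cofinite (pure e)) : c = e := by
  have hray := tendsto_pure.1 (hc.comp (tendsto_mk_mul_mk_pow hR hb hL))
  have hline := (Nat.cast_injective (R := ℤ)).tendsto_cofinite.eventually (tendsto_pure.1 he)
  rw [Nat.cofinite_eq_atTop] at hline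
  obtain ⟨n, hn, hn'⟩ := (hray.and hline).exists
  rw [zpow_natCast] at hn'
  exact hn.symm.trans hn'

/-- The axis of `mk R` through `mk L` has its two ends in the two cones. -/
theorem eq_of_tendsto_wordCone_of_eventuallyConst_zpow {a b : α × Bool} {c d : γ}
    (hR : IsCyclicallyReduced R) (ha : R.getLast? = some a) (hb : R.head? = some (letterInv b))
    (hLa : FreeGroup.IsReduced (L ++ [letterInv a]))
    (hLb : FreeGroup.IsReduced (L ++ [letterInv b]))
    (hline : EventuallyConst (fun n : ℤ => f (mk L * mk R ^ n)) cofinite)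
    (hc : Tendsto f (cofinite ⊓ 𝓟 (wordCone (L ++ [letterInv a]))) (pure c))
    (hd : Tendsto f (cofinite ⊓ 𝓟 (wordCone (L ++ [letterInv b]))) (pure d)) : c = d := by
  have : Nonempty γ := ⟨c⟩
  obtain ⟨e, he⟩ := eventuallyConst_iff_tendsto.1 hline
  have hinvRev : (invRev R).head? = some (letterInv a) := by
    rw [invRev, List.head?_reverse, List.getLast?_map, ha]
    rfl
  have he' : Tendsto (fun n : ℤ => f (mk L * mk (invRev R) ^ n)) cofinite (pure e) := by
    simpa only [Function.comp_def, ← inv_mk, inv_zpow'] using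
      he.comp (neg_injective (G := ℤ)).tendsto_cofinite
  rw [eq_of_tendsto_wordCone (isCyclicallyReduced_invRev hR) hinvRev hLa hc he',
    eq_of_tendsto_wordCone hR hb hLb hd he]

variable [Finite α]

theorem tendsto_wordCone_of_forall_append {c : γ}
    (h : ∀ a, Tendsto f (cofinite ⊓ 𝓟 (wordCone (L ++ [a]))) (pure c)) :
    Tendsto f (cofinite ⊓ 𝓟 (wordCone L)) (pure c) := by
  simp only [tendsto_pure, eventually_inf_principal] at h ⊢
  filter_upwards [eventually_all.2 h, (Set.finite_singleton (mk L)).compl_mem_cofinite]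
    with g hg hne hgL
  obtain ⟨a, ha⟩ := Set.mem_iUnion.1 ((wordCone_subset_insert_iUnion L hgL).resolve_left hne)
  exact hg a ha

theorem exists_norm_forall_mul_mk_eq (hf : almostStabilizer f = ⊤) :
    ∃ N : ℕ, ∀ g : FreeGroup α, N ≤ g.norm → ∀ a, f (g * mk [a]) = f g := by
  have hev : ∀ᶠ g in cofinite, ∀ a : α × Bool, f (g * mk [a]) = f g :=
    eventually_all.2 fun a => mem_almostStabilizer.1 (hf ▸ Subgroup.mem_top _)
  obtain ⟨M, hM⟩ := ((eventually_cofinite.1 hev).image FreeGroup.norm).bddAbove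
  refine ⟨M + 1, fun g hg => ?_⟩
  by_contra hg'
  exact (hM ⟨g, hg', rfl⟩).not_gt hg

theorem exists_length_forall_mem_wordCone_eq (hf : almostStabilizer f = ⊤) :
    ∃ N : ℕ, ∀ L : List (α × Bool), N ≤ L.length → ∀ g ∈ wordCone L, f g = f (mk L) := by
  obtain ⟨N, hN⟩ := exists_norm_forall_mul_mk_eq hf
  refine ⟨N, fun L hL => ?_⟩
  have hword : ∀ T, FreeGroup.IsReduced (L ++ T) → f (mk (L ++ T)) = f (mk L) := by
    intro T
    induction T using List.reverseRecOn with
    | nil => simp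
    | append_singleton T a ih =>
      intro hred
      rw [← List.append_assoc] at hred ⊢
      have hred' : FreeGroup.IsReduced (L ++ T) := hred.infix (List.prefix_append _ _).isInfix
      rw [← mul_mk, hN, ih hred']
      rw [FreeGroup.norm, toWord_mk, hred'.reduce_eq, List.length_append]
      omega
  rintro g ⟨T, hT⟩
  rw [← hword T (hT ▸ isReduced_toWord), hT, mk_toWord]

end Limits

section Propagation

variable {G : SimpleGraph (α × Bool)} {f : FreeGroup α → γ} {W : List (α × Bool)}

theorem preconnected_induce_isReduced_append_letterInv (hG : G.Preconnected)
    (hG' : ∀ v, (G.induce {v}ᶜ).Preconnected) {L : List (α × Bool)}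
    (hL : FreeGroup.IsReduced L) :
    (G.induce {w | FreeGroup.IsReduced (L ++ [letterInv w])}).Preconnected := by
  rcases L.eq_nil_or_concat' with rfl | ⟨L, a, rfl⟩
  · have huniv : {w : α × Bool | FreeGroup.IsReduced ([] ++ [letterInv w])} = Set.univ := by
      simp
    rw [huniv]
    exact (SimpleGraph.induceUnivIso G).preconnected_iff.2 hG
  · have hcompl : {w | FreeGroup.IsReduced (L ++ [a] ++ [letterInv w])} = {a}ᶜ :=
      Set.ext fun w => isReduced_append_letterInv_iff hL
    rw [hcompl]
    exact hG' a

variable [Finite α]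

theorem eventuallyConst_wordCone_of_forall_append [DecidableEq α] (hG : G.Preconnected)
    (hG' : ∀ v, (G.induce {v}ᶜ).Preconnected) (hW : IsCyclicallyReduced W)
    (hadj : ∀ a b, G.Adj a b → (a, b) ∈ cyclicTurns W ∨ (b, a) ∈ cyclicTurns W)
    (hline : ∀ g n, EventuallyConst (fun m : ℤ => f (g * mk (W.rotate n) ^ m)) cofinite)
    {L : List (α × Bool)} (hL : FreeGroup.IsReduced L)
    (h : ∀ a, EventuallyConst f (cofinite ⊓ 𝓟 (wordCone (L ++ [a])))) :
    EventuallyConst f (cofinite ⊓ 𝓟 (wordCone L)) := by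
  have : Nonempty γ := ⟨f 1⟩
  simp only [eventuallyConst_iff_tendsto] at h
  choose d hd using h
  let s : Set (α × Bool) := {w | FreeGroup.IsReduced (L ++ [letterInv w])}
  have hturn : ∀ a b : s, (a.1, b.1) ∈ cyclicTurns W →
      d (letterInv a) = d (letterInv b) := by
    intro a b hab
    obtain ⟨n, hb, ha⟩ := exists_rotate_of_mem_zip_rotate (mk_mem_cyclicTurns.1 hab)
    exact eq_of_tendsto_wordCone_of_eventuallyConst_zpow (isCyclicallyReduced_rotate hW n) ha hb
      a.2 b.2 (hline (mk L) n) (hd _) (hd _)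
  have hconst : ∀ a b : s, d (letterInv a) = d (letterInv b) :=
    apply_eq_of_preconnected (preconnected_induce_isReduced_append_letterInv hG hG' hL)
      fun a b hab => (hadj a b hab).elim (hturn a b) fun hba => (hturn b a hba).symm
  obtain ⟨c, hc⟩ : ∃ c, ∀ w ∈ s, d (letterInv w) = c := by
    rcases s.eq_empty_or_nonempty with hs | ⟨w, hw⟩
    · exact ⟨f 1, by simp [hs]⟩
    · exact ⟨_, fun u hu => hconst ⟨u, hu⟩ ⟨w, hw⟩⟩
  refine EventuallyConst.of_tendsto (tendsto_wordCone_of_forall_append (c := c) fun a => ?_)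
  by_cases ha : FreeGroup.IsReduced (L ++ [a])
  · have hda := hc (letterInv a) (by simpa [s] using ha)
    rw [letterInv_letterInv] at hda
    exact hda ▸ hd a
  · simp [wordCone_eq_empty ha]

theorem eventuallyConst_of_preconnected_induce_compl (hG : G.Preconnected)
    (hG' : ∀ v, (G.induce {v}ᶜ).Preconnected) (hW : IsCyclicallyReduced W)
    (hadj : ∀ a b, G.Adj a b → (a, b) ∈ cyclicTurns W ∨ (b, a) ∈ cyclicTurns W)
    (hf : almostStabilizer f = ⊤)
    (hline : ∀ g n, EventuallyConst (fun m : ℤ => f (g * mk (W.rotate n) ^ m)) cofinite) :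
    EventuallyConst f cofinite := by
  classical
  obtain ⟨N, hN⟩ := exists_length_forall_mem_wordCone_eq hf
  have hcone : ∀ (k : ℕ) (L : List (α × Bool)), N ≤ L.length + k →
      EventuallyConst f (cofinite ⊓ 𝓟 (wordCone L)) := by
    intro k
    induction k with
    | zero =>
      intro L hL
      refine EventuallyConst.of_tendsto (x := f (mk L)) (tendsto_pure.2 ?_)
      exact eventually_inf_principal.2 (Eventually.of_forall (hN L hL))
    | succ k ih =>
      intro L hk
      by_cases hL : FreeGroup.IsReduced L
      · exact eventuallyConst_wordCone_of_forall_append hG hG' hW hadj hline hL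
          fun a => ih (L ++ [a]) (by simp; omega)
      · simp [wordCone_eq_empty hL]
  simpa [wordCone] using hcone N [] (by simp)

end Propagation

end Cones

section CutVertexLemma

open FreeGroup Filter

variable {F ι : Type*} [Group F] {B : FreeGroupBasis ι F} {x : F}

theorem exists_mem_cyclicWord_fst_eq (hG : (whiteheadGraph B x).Preconnected) (i : ι) :
    ∃ w ∈ cyclicWord B x, w.1 = i := by
  have : Nonempty ι := ⟨i⟩
  obtain ⟨w, hw⟩ := hG.exists_adj_of_nontrivial (i, true)
  rcases (whiteheadGraph_adj.1 hw).2 with h | h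
  · exact ⟨_, (List.of_mem_zip (mk_mem_cyclicTurns.1 h)).1, rfl⟩
  · exact ⟨_, List.mem_rotate.1 (List.of_mem_zip (mk_mem_cyclicTurns.1 h)).2, rfl⟩

theorem finite_of_preconnected_whiteheadGraph (hG : (whiteheadGraph B x).Preconnected) :
    Finite ι := by
  refine Set.finite_univ_iff.1 (((cyclicWord B x).map Prod.fst).finite_toSet.subset fun i _ => ?_)
  obtain ⟨w, hw, rfl⟩ := exists_mem_cyclicWord_fst_eq hG i
  exact List.mem_map_of_mem hw

theorem ne_one_of_preconnected_whiteheadGraph [Nontrivial F]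
    (hG : (whiteheadGraph B x).Preconnected) : x ≠ 1 := by
  rintro rfl
  obtain ⟨i⟩ : Nonempty ι := by
    by_contra hι
    have := not_nonempty_iff.1 hι
    exact not_subsingleton F B.repr.injective.subsingleton
  obtain ⟨w, hw, -⟩ := exists_mem_cyclicWord_fst_eq hG i
  simp [cyclicWord] at hw

theorem IsSeparableSet.nontrivial {A : Finset F} (h : IsSeparableSet A) : Nontrivial F := by
  obtain ⟨F₁, -, hF₁, -⟩ := h
  obtain ⟨a, -, ha⟩ := F₁.bot_or_exists_ne_one.resolve_left hF₁
  exact ⟨a, 1, ha⟩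

theorem isConj_repr_symm_mk_rotate_cyclicWord (B : FreeGroupBasis ι F) (x : F) (n : ℕ) :
    IsConj x (B.repr.symm (mk ((cyclicWord B x).rotate n))) := by
  have hconj := (isConj_mk_cyclicWord B x).symm.trans (isConj_mk_rotate _ n)
  simpa using B.repr.symm.toMonoidHom.map_isConj hconj

theorem IsSeparableSet.not_preconnected_or_isCutVertex (h : IsSeparableSet {x})
    (B : FreeGroupBasis ι F) :
    ¬ (whiteheadGraph B x).Preconnected ∨ ∃ v, IsCutVertex (whiteheadGraph B x) v := by
  classical
  by_contra! hcon
  obtain ⟨hG, hcut⟩ := hcon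
  have := h.nontrivial
  have := finite_of_preconnected_whiteheadGraph hG
  have : IsMulTorsionFree F :=
    Function.Injective.isMulTorsionFree B.repr.toMonoidHom B.repr.injective
  obtain ⟨P, hP, hnotConst, hline⟩ :=
    h.exists_almostInvariant (ne_one_of_preconnected_whiteheadGraph hG)
  have hconst : EventuallyConst (P ∘ B.repr.symm) cofinite :=
    eventuallyConst_of_preconnected_induce_compl hG
      (fun v => preconnected_induce_compl_of_not_isCutVertex hG (hcut v))
      (isCyclicallyReduced_cyclicWord B x) (fun a b hab => (whiteheadGraph_adj.1 hab).2)
      (by rw [almostStabilizer_comp_mulEquiv, hP, Subgroup.comap_top]) fun g n => by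
        simpa using hline _ (isConj_repr_symm_mk_rotate_cyclicWord B x n) (B.repr.symm g)
  apply hnotConst
  simpa [Function.comp_def] using hconst.comp_tendsto B.repr.injective.tendsto_cofinite

end CutVertexLemma

theorem corollary2 {F : Type u} [Group F] [IsFreeGroup F] (x : F)
    (hx : x = 1 → IsEmpty (F ≃* Multiplicative ℤ)) :
    IsSeparableSet {x} ↔
      ∀ (ι : Type u) (B : FreeGroupBasis ι F),
        ¬ (whiteheadGraph B x).Preconnected ∨ ∃ v, IsCutVertex (whiteheadGraph B x) v := by
  refine ⟨fun h ι B => h.not_preconnected_or_isCutVertex B, fun h => ?_⟩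
  obtain ⟨B, -, hB⟩ := WellFounded.has_min
    (measure fun B : FreeGroupBasis (IsFreeGroup.Generators F) F => (cyclicWord B x).length).wf
    Set.univ ⟨IsFreeGroup.basis F, trivial⟩
  have hmin : ¬ ∃ B' : FreeGroupBasis (IsFreeGroup.Generators F) F,
      (cyclicWord B' x).length < (cyclicWord B x).length :=
    fun ⟨B', hB'⟩ => hB B' trivial hB'
  by_cases hG : (whiteheadGraph B x).Preconnected
  · obtain ⟨v, hv⟩ := (h _ B).resolve_left (not_not.2 hG)
    exact absurd (exists_length_cyclicWord_lt_of_isCutVertex hG hv) hmin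
  · exact (isSeparableSet_or_exists_length_lt_of_not_preconnected hx hG).resolve_right hmin
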